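/- Let $D\ge 1$ and $n_1,\dots,n_D\ge 1$ be integers, put $N=\sum_{d=1}^D n_d$ and $n_*=\max\{n_1,\dots,n_D\}$, and assume $N\ge 2$ (that is, exclude only the case $D=n_1=1$ of a single number). For a tensor $X\in\mathbb R^{n_1\times\cdots\times n_D}$ let $X_{(d)}$ be its mode-$d$ matricization (an $n_d\times\prod_{j\ne d}n_j$ matrix), let $\sigma^{(d)}(X)\in\mathbb R^{n_d}$ be the vector of its singular values in decreasing order (completed by zeros), and let $\sigma(X)=\frac1{\sqrt D}(\sigma^{(1)}(X),\dots,\sigma^{(D)}(X))\in\mathbb R^N$. For $\alpha\ge 0$ the dual Romera-Paredes--Pontil function is $$\omega_\alpha^*(g)=\sup_{\|s\|_2\le\alpha}\ \langle g,s\rangle-\|s\|_0\quad(g\in\mathbb R^N),\qquad \omega_\alpha^*(X):=\omega_\alpha^*(\sigma(X)),$$ where $\|s\|_0$ is the number of nonzero coordinates of $s$. Let $X$ be a random tensor with i.i.d. standard Gaussian entries and let $\alpha\ge 0$. Then $\omega_\alpha^*(X)$ is integrable. Moreover, let $r\in\{1,\dots,N\}$ and let $c$ be either of the binomial coefficients $\binom{r-1}{D-1}$,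 $\binom{D-1}{r-1}$, provided that it is nonzero, and put $$p=c\,3^{\,r n_*},\qquad q=r n_*+\Big(\frac rD\Big)^D .$$ Then $$\mathbb E\left[\omega_\alpha^*(X)\right]\le 8\sqrt2\,\alpha\,\Bigg[\sqrt{\log p}\;\frac{(1+N)^{D+1}-2^{D+1}}{D+1}+\frac14\sqrt{\pi q}\,\Big(N+\frac{N(1+N)^D-2^D}{D}+\frac{2^{D+1}-(1+N)^{D+1}}{D(D+1)}\Big)-\frac{N(1+N)}2\Bigg].$$ -/

import Mathlib

open MeasureTheory ProbabilityTheory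

noncomputable section

/-- Real `n 0 × ⋯ × n (D - 1)` tensors: arrays indexed by the multi-indices `(i_d)_d`. -/
abbrev RealTensor {D : ℕ} (n : Fin D → ℕ) : Type := ((d : Fin D) → Fin (n d)) → ℝ

/-- The mode-`d` matricization: rows are indexed by the `d`-th coordinate, columns by all the other
coordinates. (The ordering of the columns does not affect the singular values.) -/
def RealTensor.matricization {D : ℕ} {n : Fin D → ℕ} (X : RealTensor n) (d : Fin D) :
    Matrix (Fin (n d)) ((j : {j : Fin D // j ≠ d}) → Fin (n j)) ℝ :=
  Matrix.of fun i J => X ((Equiv.piSplitAt d (fun j => Fin (n j))).symm (i, J))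

/-- The mode-`d` spectrum: the vector in `ℝ ^ (n d)` of the singular values of the mode-`d`
matricization, in decreasing order and with multiplicity. The matricization has `n d` rows, hence
at most `n d` nonzero singular values; the vector is completed by zeros. -/
def RealTensor.modeSpectrum {D : ℕ} {n : Fin D → ℕ} (X : RealTensor n) (d : Fin D) :
    Fin (n d) → ℝ :=
  fun k => (Matrix.toEuclideanLin (X.matricization d)).singularValues k

/-- The spectrum `σ(X) = D^(-1/2) (σ⁽¹⁾(X), …, σ⁽ᴰ⁾(X))`, a vector of Euclidean space of
dimension `∑ d, n d`. -/
def RealTensor.spectrumVec {D : ℕ} {n : Fin D → ℕ} (X : RealTensor n) :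
    EuclideanSpace ℝ (Σ d : Fin D, Fin (n d)) :=
  WithLp.toLp 2 fun dk => (1 / √(D : ℝ)) * X.modeSpectrum dk.1 dk.2

/-- The number of nonzero coordinates `‖s‖₀`. -/
def cardNonzero {ι : Type*} [Fintype ι] (s : EuclideanSpace ℝ ι) : ℕ :=
  {i : ι | s i ≠ 0}.ncard

/-- The dual Romera-Paredes--Pontil function `sup_{‖s‖₂ ≤ α} ⟨g, s⟩ - ‖s‖₀`. -/
def dualRPP {ι : Type*} [Fintype ι] (α : ℝ) (g : EuclideanSpace ℝ ι) : ℝ :=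
  sSup {t : ℝ | ∃ s : EuclideanSpace ℝ ι, ‖s‖ ≤ α ∧ t = inner ℝ g s - (cardNonzero s : ℝ)}

/-- The dual Romera-Paredes--Pontil function of a tensor, that is, of its spectrum. -/
def RealTensor.dualRPP {D : ℕ} {n : Fin D → ℕ} (α : ℝ) (X : RealTensor n) : ℝ :=
  _root_.dualRPP α X.spectrumVec

/-- The expression
`√(log p) ((1+N)^(D+1) - 2^(D+1))/(D+1) + (1/4) √(π q) (N + (N(1+N)^D - 2^D)/D
  + (2^(D+1) - (1+N)^(D+1))/(D(D+1))) - N(1+N)/2`. -/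
def rppBound (N D : ℕ) (p q : ℝ) : ℝ :=
  (√(Real.log p) * (((1 + N : ℝ) ^ (D + 1) - 2 ^ (D + 1)) / (D + 1))
    + 1 / 4 * √(Real.pi * q) *
      (N + (N * (1 + N : ℝ) ^ D - 2 ^ D) / D
        + (2 ^ (D + 1) - (1 + N : ℝ) ^ (D + 1)) / (D * (D + 1))))
  - (N * (1 + N) : ℝ) / 2

end

/-!
By Cauchy–Schwarz `⟨g, s⟩ - ‖s‖₀ ≤ α ‖g‖` for `‖s‖ ≤ α`, and every matricization of `X` has the
Frobenius norm of `X`, so `0 ≤ ω*_α(X) ≤ α ‖σ(X)‖ ≤ α ‖X‖`. Together with the measurability of the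
spectrum, which is continuous since singular values are `1`-Lipschitz in the operator norm (Weyl),
this gives integrability, and Jensen's inequality gives `𝔼 ω*_α(X) ≤ α √(∏ n_d) ≤ α √(N ^ D)`.

The right-hand side of the theorem dominates this crude bound. Since `p ≥ e` and `q ≥ 1`, the
midpoint (Hermite–Hadamard) inequality on `[2, 1 + N]` bounds the bracket from below by
`(N - 1) ((N + 3) / 2) ^ D + 3 N / 8 - N (1 + N) / 2`, and `8 √2` times this exceeds
`((N + 3) / 2) ^ D ≥ √(N ^ D)`.
-/

section SingularValues

open Module

variable {𝕜 : Type*} [RCLike 𝕜]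
  {E : Type*} [NormedAddCommGroup E] [InnerProductSpace 𝕜 E] [FiniteDimensional 𝕜 E]
  {F : Type*} [NormedAddCommGroup F] [InnerProductSpace 𝕜 F] [FiniteDimensional 𝕜 F]

/-- An orthonormal basis of right singular vectors of `T`, that is, of eigenvectors of `T* T`,
listed in the decreasing order of the singular values. -/
noncomputable def rightSingularBasis (T : E →ₗ[𝕜] F) :
    OrthonormalBasis (Fin (finrank 𝕜 E)) 𝕜 E :=
  T.isSymmetric_adjoint_comp_self.eigenvectorBasis rfl

theorem adjoint_apply_rightSingularBasis (T : E →ₗ[𝕜] F) (i : Fin (finrank 𝕜 E)) :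
    T.adjoint (T (rightSingularBasis T i)) =
      ((T.singularValues i ^ 2 : ℝ) : 𝕜) • rightSingularBasis T i := by
  rw [T.sq_singularValues_fin rfl i]
  exact T.isSymmetric_adjoint_comp_self.apply_eigenvectorBasis rfl i

theorem sum_sq_singularValues_mul_sq_norm_inner (T : E →ₗ[𝕜] F) (x : E) :
    ∑ i : Fin (finrank 𝕜 E), T.singularValues i ^ 2 *
      ‖inner 𝕜 (rightSingularBasis T i) x‖ ^ 2 = ‖T x‖ ^ 2 := by
  have hinner (i : Fin (finrank 𝕜 E)) : inner 𝕜 (rightSingularBasis T i) (T.adjoint (T x)) =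
      ((T.singularValues i ^ 2 : ℝ) : 𝕜) * inner 𝕜 (rightSingularBasis T i) x := by
    rw [LinearMap.adjoint_inner_right, ← LinearMap.adjoint_inner_left,
      adjoint_apply_rightSingularBasis, inner_smul_left, RCLike.conj_ofReal]
  rw [← RCLike.ofReal_inj (K := 𝕜), RCLike.ofReal_pow, ← inner_self_eq_norm_sq_to_K,
    ← LinearMap.adjoint_inner_right, ← (rightSingularBasis T).sum_inner_mul_inner]
  push_cast
  refine Finset.sum_congr rfl fun i _ => ?_
  rw [hinner, mul_left_comm, ← inner_conj_symm x, RCLike.conj_mul]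
  push_cast
  rfl

theorem singularValues_mul_norm_le_norm_apply (T : E →ₗ[𝕜] F) {k : ℕ} {x : E}
    (hx : ∀ i : Fin (finrank 𝕜 E), k < i → inner 𝕜 (rightSingularBasis T i) x = 0) :
    T.singularValues k * ‖x‖ ≤ ‖T x‖ := by
  refine le_of_sq_le_sq ?_ (norm_nonneg _)
  rw [← sum_sq_singularValues_mul_sq_norm_inner, mul_pow,
    ← (rightSingularBasis T).sum_sq_norm_inner_right x, Finset.mul_sum]
  refine Finset.sum_le_sum fun i _ => ?_
  rcases lt_or_ge k i with hi | hi
  · simp [hx i hi]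
  · gcongr
    · exact T.singularValues_nonneg k
    · exact T.singularValues_antitone hi

theorem norm_apply_le_singularValues_mul_norm (T : E →ₗ[𝕜] F) {k : ℕ} {x : E}
    (hx : ∀ i : Fin (finrank 𝕜 E), i < k → inner 𝕜 (rightSingularBasis T i) x = 0) :
    ‖T x‖ ≤ T.singularValues k * ‖x‖ := by
  refine le_of_sq_le_sq ?_ (mul_nonneg (T.singularValues_nonneg k) (norm_nonneg x))
  rw [← sum_sq_singularValues_mul_sq_norm_inner, mul_pow,
    ← (rightSingularBasis T).sum_sq_norm_inner_right x, Finset.mul_sum]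
  refine Finset.sum_le_sum fun i _ => ?_
  rcases lt_or_ge (i : ℕ) k with hi | hi
  · simp [hx i hi]
  · gcongr
    · exact T.singularValues_nonneg i
    · exact T.singularValues_antitone hi

variable {G : Type*} [NormedAddCommGroup G] [InnerProductSpace 𝕜 G] [FiniteDimensional 𝕜 G]

-- The conditions of the two preceding lemmas are `finrank 𝕜 E - 1` linear equations for `x`.
theorem exists_ne_zero_singularValues_mul_norm_le (T : E →ₗ[𝕜] F) (S : E →ₗ[𝕜] G) {k : ℕ}
    (hk : k < finrank 𝕜 E) :
    ∃ x ≠ 0, T.singularValues k * ‖x‖ ≤ ‖T x‖ ∧ ‖S x‖ ≤ S.singularValues k * ‖x‖ := by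
  let b (i : Fin (finrank 𝕜 E)) : E :=
    if k < i then rightSingularBasis T i else rightSingularBasis S i
  let φ : E →ₗ[𝕜] ({i : Fin (finrank 𝕜 E) // i ≠ ⟨k, hk⟩} → 𝕜) :=
    LinearMap.pi fun i => (innerSL 𝕜 (b i)).toLinearMap
  have hker : φ.ker ≠ ⊥ := φ.ker_ne_bot_of_finrank_lt (by
    simp only [finrank_fintype_fun_eq_card, ne_eq, Fintype.card_subtype_compl, Fintype.card_fin,
      Fintype.card_unique]
    omega)
  obtain ⟨x, hx, hx0⟩ := (Submodule.ne_bot_iff _).1 hker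
  have hb (i : Fin (finrank 𝕜 E)) (hi : (i : ℕ) ≠ k) : inner 𝕜 (b i) x = 0 :=
    congrFun hx ⟨i, fun h => hi (congrArg Fin.val h)⟩
  refine ⟨x, hx0, singularValues_mul_norm_le_norm_apply T fun i hi => ?_,
    norm_apply_le_singularValues_mul_norm S fun i hi => ?_⟩
  · simpa only [b, if_pos hi] using hb i hi.ne'
  · simpa only [b, if_neg hi.not_gt] using hb i hi.ne

theorem singularValues_le_add_norm_sub (T S : E →L[𝕜] F) (k : ℕ) :
    (T : E →ₗ[𝕜] F).singularValues k ≤ (S : E →ₗ[𝕜] F).singularValues k + ‖T - S‖ := by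
  rcases le_or_gt (finrank 𝕜 E) k with hk | hk
  · rw [LinearMap.singularValues_of_finrank_le _ hk]
    exact add_nonneg (LinearMap.singularValues_nonneg _ k) (norm_nonneg _)
  obtain ⟨x, hx0, hT, hS⟩ := exists_ne_zero_singularValues_mul_norm_le
    (T : E →ₗ[𝕜] F) (S : E →ₗ[𝕜] F) hk
  refine le_of_mul_le_mul_right ?_ (norm_pos_iff.2 hx0)
  calc (T : E →ₗ[𝕜] F).singularValues k * ‖x‖ ≤ ‖T x‖ := hT
    _ = ‖S x + (T - S) x‖ := by simp
    _ ≤ ‖S x‖ + ‖(T - S) x‖ := norm_add_le _ _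
    _ ≤ (S : E →ₗ[𝕜] F).singularValues k * ‖x‖ + ‖T - S‖ * ‖x‖ :=
      add_le_add hS ((T - S).le_opNorm x)
    _ = ((S : E →ₗ[𝕜] F).singularValues k + ‖T - S‖) * ‖x‖ := by ring

theorem lipschitzWith_singularValues (k : ℕ) :
    LipschitzWith 1 fun T : E →L[𝕜] F => (T : E →ₗ[𝕜] F).singularValues k :=
  LipschitzWith.of_le_add fun T S => dist_eq_norm T S ▸ singularValues_le_add_norm_sub T S k

theorem sum_range_sq_singularValues {ι : Type*} [Fintype ι] (T : E →ₗ[𝕜] F)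
    (b : OrthonormalBasis ι 𝕜 E) {m : ℕ} (hm : finrank 𝕜 T.range ≤ m) :
    ∑ k ∈ Finset.range m, T.singularValues k ^ 2 = ∑ i, ‖T (b i)‖ ^ 2 := by
  have hzero (k : ℕ) (hk : k ∉ Finset.range (finrank 𝕜 T.range)) : T.singularValues k ^ 2 = 0 := by
    rw [T.singularValues_eq_zero_iff_le_finrank_range.2 (by simpa using hk), zero_pow two_ne_zero]
  have hcut {l : ℕ} (hl : finrank 𝕜 T.range ≤ l) :
      ∑ k ∈ Finset.range (finrank 𝕜 T.range), T.singularValues k ^ 2 =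
        ∑ k ∈ Finset.range l, T.singularValues k ^ 2 :=
    Finset.sum_subset (Finset.range_mono hl) fun k _ => hzero k
  calc ∑ k ∈ Finset.range m, T.singularValues k ^ 2
    _ = ∑ k : Fin (finrank 𝕜 E), T.singularValues k ^ 2 := by
      rw [← hcut hm, hcut T.finrank_range_le, Finset.sum_range]
    _ = ∑ k : Fin (finrank 𝕜 E), T.singularValues k ^ 2 *
          ∑ i, ‖inner 𝕜 (rightSingularBasis T k) (b i)‖ ^ 2 := by
      simp only [b.sum_sq_norm_inner_left, OrthonormalBasis.norm_eq_one, one_pow, mul_one]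
    _ = ∑ i, ‖T (b i)‖ ^ 2 := by
      simp only [Finset.mul_sum, ← sum_sq_singularValues_mul_sq_norm_inner]
      exact Finset.sum_comm

end SingularValues

section Spectrum

theorem continuous_toContinuousLinearMap_toEuclideanLin {𝕜 m n : Type*} [RCLike 𝕜] [Fintype m]
    [Fintype n] [DecidableEq n] :
    Continuous fun A : Matrix m n 𝕜 => (Matrix.toEuclideanLin A).toContinuousLinearMap := by
  let L : Matrix m n 𝕜 →ₗ[𝕜] EuclideanSpace 𝕜 n →L[𝕜] EuclideanSpace 𝕜 m :=
    LinearMap.toContinuousLinearMap.toLinearMap ∘ₗ Matrix.toEuclideanLin.toLinearMap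
  exact L.continuous_of_finiteDimensional

variable {D : ℕ} {n : Fin D → ℕ}

theorem RealTensor.continuous_modeSpectrum (d : Fin D) (k : Fin (n d)) :
    Continuous fun X : RealTensor n => X.modeSpectrum d k := by
  have hmat : Continuous fun X : RealTensor n => X.matricization d :=
    continuous_matrix fun _ _ => continuous_apply _
  have hlin := continuous_toContinuousLinearMap_toEuclideanLin.comp hmat
  exact ((lipschitzWith_singularValues k).continuous.comp hlin :)

theorem RealTensor.continuous_spectrumVec : Continuous fun X : RealTensor n => X.spectrumVec :=
  (PiLp.continuous_toLp 2 _).comp <| continuous_pi fun dk =>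
    continuous_const.mul (RealTensor.continuous_modeSpectrum dk.1 dk.2)

theorem RealTensor.sum_sq_modeSpectrum (X : RealTensor n) (d : Fin D) :
    ∑ k, X.modeSpectrum d k ^ 2 = ∑ i, X i ^ 2 := by
  have hrank : Module.finrank ℝ (Matrix.toEuclideanLin (X.matricization d)).range ≤ n d :=
    (Submodule.finrank_le _).trans_eq (by simp)
  have hcol (J : (j : {j : Fin D // j ≠ d}) → Fin (n j)) :
      ‖Matrix.toEuclideanLin (X.matricization d) (EuclideanSpace.basisFun _ ℝ J)‖ ^ 2 =
        ∑ i, X.matricization d i J ^ 2 := by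
    simp [EuclideanSpace.norm_sq_eq, Matrix.toLpLin_apply]
  calc ∑ k, X.modeSpectrum d k ^ 2
    _ = ∑ J, ∑ i, X.matricization d i J ^ 2 := by
      simp only [← hcol, ← sum_range_sq_singularValues _ _ hrank, Finset.sum_range]
      rfl
    _ = ∑ i, X i ^ 2 := by
      rw [← (Equiv.piSplitAt d fun j => Fin (n j)).symm.sum_comp, Fintype.sum_prod_type_right]
      rfl

theorem RealTensor.norm_spectrumVec_le (X : RealTensor n) :
    ‖X.spectrumVec‖ ≤ ‖WithLp.toLp 2 X‖ := by
  refine le_of_sq_le_sq ?_ (norm_nonneg _)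
  calc ‖X.spectrumVec‖ ^ 2
    _ = ∑ d, (D : ℝ)⁻¹ * ∑ k, X.modeSpectrum d k ^ 2 := by
      simp [EuclideanSpace.norm_sq_eq, Fintype.sum_sigma, RealTensor.spectrumVec, mul_pow,
        Finset.mul_sum]
    _ = D * (D : ℝ)⁻¹ * ‖WithLp.toLp 2 X‖ ^ 2 := by
      simp [X.sum_sq_modeSpectrum, EuclideanSpace.norm_sq_eq, mul_assoc]
    _ ≤ ‖WithLp.toLp 2 X‖ ^ 2 := mul_le_of_le_one_left (sq_nonneg _) mul_inv_le_one

end Spectrum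

section DualRPP

variable {ι : Type*} [Fintype ι] {α : ℝ}

theorem inner_sub_cardNonzero_le (g : EuclideanSpace ℝ ι) {s : EuclideanSpace ℝ ι}
    (hs : ‖s‖ ≤ α) : inner ℝ g s - (cardNonzero s : ℝ) ≤ α * ‖g‖ :=
  calc inner ℝ g s - (cardNonzero s : ℝ) ≤ inner ℝ g s := sub_le_self _ (Nat.cast_nonneg _)
    _ ≤ ‖g‖ * ‖s‖ := real_inner_le_norm g s
    _ ≤ ‖g‖ * α := by gcongr
    _ = α * ‖g‖ := mul_comm _ _

theorem inner_sub_cardNonzero_le_dualRPP (g : EuclideanSpace ℝ ι) {s : EuclideanSpace ℝ ι}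
    (hs : ‖s‖ ≤ α) : inner ℝ g s - (cardNonzero s : ℝ) ≤ dualRPP α g :=
  le_csSup ⟨α * ‖g‖, by rintro _ ⟨t, ht, rfl⟩; exact inner_sub_cardNonzero_le g ht⟩ ⟨s, hs, rfl⟩

theorem dualRPP_le (hα : 0 ≤ α) {g : EuclideanSpace ℝ ι} {a : ℝ}
    (h : ∀ s : EuclideanSpace ℝ ι, ‖s‖ ≤ α → inner ℝ g s - (cardNonzero s : ℝ) ≤ a) :
    dualRPP α g ≤ a :=
  csSup_le ⟨_, 0, by rwa [norm_zero], rfl⟩ (by rintro _ ⟨s, hs, rfl⟩; exact h s hs)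

theorem dualRPP_nonneg (hα : 0 ≤ α) (g : EuclideanSpace ℝ ι) : 0 ≤ dualRPP α g := by
  have hzero : ‖(0 : EuclideanSpace ℝ ι)‖ ≤ α := by rwa [norm_zero]
  simpa [cardNonzero] using inner_sub_cardNonzero_le_dualRPP g hzero

theorem dualRPP_le_mul_norm (hα : 0 ≤ α) (g : EuclideanSpace ℝ ι) : dualRPP α g ≤ α * ‖g‖ :=
  dualRPP_le hα fun _ hs => inner_sub_cardNonzero_le g hs

theorem lipschitzWith_dualRPP (hα : 0 ≤ α) :
    LipschitzWith α.toNNReal (dualRPP α : EuclideanSpace ℝ ι → ℝ) :=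
  LipschitzWith.of_le_add_mul _ fun g g' => dualRPP_le hα fun s hs => by
    rw [Real.coe_toNNReal α hα, dist_eq_norm]
    calc inner ℝ g s - (cardNonzero s : ℝ)
      _ = (inner ℝ g' s - cardNonzero s) + inner ℝ (g - g') s := by rw [inner_sub_left]; ring
      _ ≤ dualRPP α g' + α * ‖g - g'‖ := by
        gcongr
        · exact inner_sub_cardNonzero_le_dualRPP g' hs
        · calc inner ℝ (g - g') s ≤ ‖g - g'‖ * ‖s‖ := real_inner_le_norm _ _
            _ ≤ α * ‖g - g'‖ := by rw [mul_comm]; gcongr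

variable {D : ℕ} {n : Fin D → ℕ}

theorem RealTensor.dualRPP_nonneg (hα : 0 ≤ α) (X : RealTensor n) : 0 ≤ X.dualRPP α :=
  _root_.dualRPP_nonneg hα X.spectrumVec

theorem RealTensor.continuous_dualRPP (hα : 0 ≤ α) :
    Continuous fun X : RealTensor n => X.dualRPP α :=
  (lipschitzWith_dualRPP hα).continuous.comp RealTensor.continuous_spectrumVec

theorem RealTensor.dualRPP_le_mul_norm (hα : 0 ≤ α) (X : RealTensor n) :
    X.dualRPP α ≤ α * ‖WithLp.toLp 2 X‖ :=
  (_root_.dualRPP_le_mul_norm hα _).trans (mul_le_mul_of_nonneg_left X.norm_spectrumVec_le hα)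

end DualRPP

section Expectation

variable {Ω : Type*} [MeasurableSpace Ω] {P : Measure Ω}

theorem integral_norm_le_sqrt_integral_norm_sq [IsProbabilityMeasure P] {E : Type*}
    [NormedAddCommGroup E] {Y : Ω → E} (hY : MemLp Y 2 P) :
    ∫ w, ‖Y w‖ ∂P ≤ √(∫ w, ‖Y w‖ ^ 2 ∂P) := by
  refine Real.le_sqrt_of_sq_le (sub_nonneg.1 ?_)
  exact (variance_nonneg (fun w => ‖Y w‖) P).trans_eq (variance_eq_sub hY.norm)

theorem integral_sq_of_hasLaw_gaussianReal {Y : Ω → ℝ} {μ : ℝ} {v : NNReal}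
    (hY : HasLaw Y (gaussianReal μ v) P) : ∫ w, Y w ^ 2 ∂P = μ ^ 2 + v := by
  have := hY.isProbabilityMeasure
  have hvar := variance_eq_sub hY.hasGaussianLaw.memLp_two
  rw [hY.variance_eq, variance_id_gaussianReal, hY.integral_eq, integral_id_gaussianReal] at hvar
  simp only [Pi.pow_apply] at hvar
  linarith

variable {D : ℕ} {n : Fin D → ℕ} {X : Ω → RealTensor n} {α : ℝ}

theorem RealTensor.integrable_dualRPP (hα : 0 ≤ α) (hX : ∀ i, Integrable (fun w => X w i) P) :
    Integrable (fun w => (X w).dualRPP α) P := by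
  have hnorm : Integrable (fun w => α * ‖WithLp.toLp 2 (X w)‖) P :=
    (integrable_piLp_iff.2 hX).norm.const_mul α
  have hmeas : AEMeasurable X P := aemeasurable_pi_lambda _ fun i => (hX i).aemeasurable
  refine hnorm.mono' ((RealTensor.continuous_dualRPP hα).measurable.comp_aemeasurable
    hmeas).aestronglyMeasurable (ae_of_all _ fun w => ?_)
  rw [Real.norm_of_nonneg (RealTensor.dualRPP_nonneg hα _)]
  exact RealTensor.dualRPP_le_mul_norm hα (X w)

theorem RealTensor.integral_dualRPP_le [IsProbabilityMeasure P] (hα : 0 ≤ α)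
    (hX : ∀ i, MemLp (fun w => X w i) 2 P) :
    ∫ w, (X w).dualRPP α ∂P ≤ α * √(∑ i, ∫ w, X w i ^ 2 ∂P) := by
  have hint (i) : Integrable (fun w => X w i) P := (hX i).integrable one_le_two
  have hmem : MemLp (fun w => WithLp.toLp 2 (X w)) 2 P := memLp_piLp_iff.2 hX
  calc ∫ w, (X w).dualRPP α ∂P
    _ ≤ ∫ w, α * ‖WithLp.toLp 2 (X w)‖ ∂P :=
      integral_mono (RealTensor.integrable_dualRPP hα hint)
        ((hmem.integrable one_le_two).norm.const_mul α)
        fun w => RealTensor.dualRPP_le_mul_norm hα (X w)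
    _ = α * ∫ w, ‖WithLp.toLp 2 (X w)‖ ∂P := integral_const_mul _ _
    _ ≤ α * √(∫ w, ‖WithLp.toLp 2 (X w)‖ ^ 2 ∂P) := by
      gcongr
      exact integral_norm_le_sqrt_integral_norm_sq hmem
    _ = α * √(∑ i, ∫ w, X w i ^ 2 ∂P) := by
      simp only [EuclideanSpace.real_norm_sq_eq,
        integral_finsetSum _ fun i _ => (hX i).integrable_sq]

end Expectation

section NumericalBound

theorem pow_succ_sub_pow_succ_div_le {x y : ℝ} (hx : 0 ≤ x) (hxy : x ≤ y) (k : ℕ) :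
    (y ^ (k + 1) - x ^ (k + 1)) / (k + 1) ≤ (y - x) * y ^ k := by
  have h := (le_abs_self _).trans (abs_pow_sub_pow_le y x (k + 1))
  rw [abs_of_nonneg (sub_nonneg.2 hxy), abs_of_nonneg hx, abs_of_nonneg (hx.trans hxy),
    max_eq_left hxy, Nat.add_sub_cancel] at h
  rw [div_le_iff₀ (by positivity)]
  push_cast at h
  linarith

-- In the binomial expansion of the right-hand side the even powers of `h` cancel.
theorem two_mul_succ_mul_pow_le_add_pow_sub_sub_pow {m h : ℝ} (hm : 0 ≤ m) (hh : 0 ≤ h) (k : ℕ) :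
    2 * (k + 1) * m ^ k * h ≤ (m + h) ^ (k + 1) - (m - h) ^ (k + 1) := by
  let term (j : ℕ) : ℝ := (h ^ j - (-h) ^ j) * m ^ (k + 1 - j) * (k + 1).choose j
  have hterm (j : ℕ) : 0 ≤ term j := by
    have : 0 ≤ h ^ j - (-h) ^ j := by
      rcases j.even_or_odd with hj | hj
      · rw [hj.neg_pow, sub_self]
      · rw [hj.neg_pow, sub_neg_eq_add]
        positivity
    positivity
  calc 2 * (k + 1) * m ^ k * h
    _ = term 1 := by
      simp only [term, pow_one, sub_neg_eq_add, Nat.add_sub_cancel, Nat.choose_one_right]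
      push_cast
      ring
    _ ≤ ∑ j ∈ Finset.range (k + 1 + 1), term j :=
      Finset.single_le_sum (fun j _ => hterm j) (by simp)
    _ = (m + h) ^ (k + 1) - (m - h) ^ (k + 1) := by
      rw [add_comm m h, sub_eq_neg_add m h, add_pow, add_pow, ← Finset.sum_sub_distrib]
      simp only [term, sub_mul]

theorem mul_midpoint_pow_le {x y : ℝ} (hxy : x ≤ y) (h0 : 0 ≤ x + y) (k : ℕ) :
    (y - x) * ((x + y) / 2) ^ k ≤ (y ^ (k + 1) - x ^ (k + 1)) / (k + 1) := by
  have h := two_mul_succ_mul_pow_le_add_pow_sub_sub_pow (m := (x + y) / 2) (h := (y - x) / 2)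
    (by linarith) (by linarith) k
  rw [show (x + y) / 2 + (y - x) / 2 = y by ring, show (x + y) / 2 - (y - x) / 2 = x by ring] at h
  rw [le_div_iff₀ (by positivity)]
  linarith

theorem midpoint_bound_le_rppBound {N D : ℕ} (hD : D ≠ 0) (hN : 1 ≤ N) {p q : ℝ}
    (hp : Real.exp 1 ≤ p) (hq : 1 ≤ q) :
    (N - 1) * ((N + 3) / 2 : ℝ) ^ D + 3 / 8 * N - N * (1 + N) / 2 ≤ rppBound N D p q := by
  have hN' : (1 : ℝ) ≤ N := by exact_mod_cast hN
  have hlog : 1 ≤ √(Real.log p) := by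
    rwa [Real.one_le_sqrt, Real.le_log_iff_exp_le ((Real.exp_pos 1).trans_le hp)]
  have hsqrt : 3 / 2 ≤ √(Real.pi * q) := by
    refine Real.le_sqrt_of_sq_le ?_
    nlinarith [Real.pi_gt_three]
  set A : ℝ := ((1 + N : ℝ) ^ (D + 1) - 2 ^ (D + 1)) / (D + 1) with hA
  have hA_ge : (N - 1) * ((N + 3) / 2 : ℝ) ^ D ≤ A := by
    convert mul_midpoint_pow_le (x := 2) (y := 1 + N) (by linarith) (by linarith) D using 1
    ring
  have hA_le : A ≤ N * (1 + N : ℝ) ^ D - 2 ^ D := by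
    have hpow : (2 : ℝ) ^ D ≤ (1 + N) ^ D := by gcongr; linarith
    have := pow_succ_sub_pow_succ_div_le (x := 2) (y := 1 + N) (by norm_num) (by linarith) D
    linarith
  have hB : (N : ℝ) ≤ N + (N * (1 + N : ℝ) ^ D - 2 ^ D) / D
      + (2 ^ (D + 1) - (1 + N : ℝ) ^ (D + 1)) / (D * (D + 1)) := by
    have heq : (2 ^ (D + 1) - (1 + N : ℝ) ^ (D + 1)) / (D * (D + 1)) = -A / D := by
      rw [hA]
      field_simp
      ring
    rw [heq, add_assoc, ← add_div]
    exact le_add_of_nonneg_right (div_nonneg (by linarith) (by positivity))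
  have hA0 : 0 ≤ A := le_trans (mul_nonneg (by linarith) (by positivity)) hA_ge
  have hlogA : A ≤ √(Real.log p) * A := le_mul_of_one_le_left hA0 hlog
  have hsqrtB := mul_le_mul hsqrt hB (by positivity) (by positivity)
  unfold rppBound
  linarith

theorem sqrt_pow_le_rppBound {N D : ℕ} (hD : D ≠ 0) (hN : 2 ≤ N) {p q : ℝ}
    (hp : Real.exp 1 ≤ p) (hq : 1 ≤ q) : √((N : ℝ) ^ D) ≤ 8 * √2 * rppBound N D p q := by
  have hN' : (2 : ℝ) ≤ N := by exact_mod_cast hN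
  set m : ℝ := (N + 3) / 2 with hm
  have hroot : √((N : ℝ) ^ D) ≤ m ^ D := by
    refine Real.sqrt_le_iff.2 ⟨by positivity, ?_⟩
    rw [← pow_mul, mul_comm, pow_mul]
    gcongr
    nlinarith
  have hpow : m ≤ m ^ D := le_self_pow₀ (by linarith) hD
  have hbound := midpoint_bound_le_rppBound hD (one_le_two.trans hN) hp hq
  have hmid : m ^ D ≤ 10 * ((N - 1) * m ^ D + 3 / 8 * N - N * (1 + N) / 2) := by
    nlinarith [mul_le_mul_of_nonneg_left hpow (by linarith : (0 : ℝ) ≤ 10 * N - 11)]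
  have hsqrt2 : 5 / 4 ≤ √(2 : ℝ) := Real.le_sqrt_of_sq_le (by norm_num)
  have hpos : 0 ≤ rppBound N D p q := by
    have : 0 ≤ m ^ D := by positivity
    linarith
  calc √((N : ℝ) ^ D) ≤ m ^ D := hroot
    _ ≤ 10 * rppBound N D p q := by linarith
    _ ≤ 8 * √2 * rppBound N D p q := by gcongr; linarith

theorem exp_one_le_natCast_mul_three_pow {c k : ℕ} (hc : c ≠ 0) (hk : k ≠ 0) :
    Real.exp 1 ≤ c * 3 ^ k := by
  have hc' : (1 : ℝ) ≤ c := by exact_mod_cast Nat.one_le_iff_ne_zero.2 hc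
  calc Real.exp 1 ≤ 3 := Real.exp_one_lt_three.le
    _ ≤ 3 ^ k := le_self_pow₀ (by norm_num) hk
    _ ≤ c * 3 ^ k := le_mul_of_one_le_left (by positivity) hc'

end NumericalBound

theorem mainTheorem5_general {Ω : Type*} [MeasurableSpace Ω] {P : Measure Ω}
    [IsProbabilityMeasure P] {D : ℕ} {n : Fin D → ℕ} (hN : 2 ≤ ∑ d, n d)
    {X : Ω → RealTensor n} (hX : ∀ i, MemLp (fun w => X w i) 2 P)
    (hX_sq : ∀ i, ∫ w, X w i ^ 2 ∂P ≤ 1) {α : ℝ} (hα : 0 ≤ α) :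
    Integrable (fun w => (X w).dualRPP α) P ∧
    ∀ p q : ℝ, Real.exp 1 ≤ p → 1 ≤ q →
      ∫ w, (X w).dualRPP α ∂P ≤ 8 * √2 * α * rppBound (∑ d, n d) D p q := by
  refine ⟨RealTensor.integrable_dualRPP hα fun i => (hX i).integrable one_le_two,
    fun p q hp hq => ?_⟩
  have hD : D ≠ 0 := by rintro rfl; simp at hN
  have hentries : ∑ i, ∫ w, X w i ^ 2 ∂P ≤ ((∑ d, n d : ℕ) : ℝ) ^ D := by
    calc ∑ i, ∫ w, X w i ^ 2 ∂P ≤ ∑ _i : (d : Fin D) → Fin (n d), (1 : ℝ) :=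
          Finset.sum_le_sum fun i _ => hX_sq i
      _ = ((∏ d, n d : ℕ) : ℝ) := by simp
      _ ≤ ((∑ d, n d : ℕ) : ℝ) ^ D := by
        exact_mod_cast (Finset.prod_le_pow_card _ n _ fun d hd =>
          Finset.single_le_sum (fun _ _ => Nat.zero_le _) hd).trans_eq (by simp)
  calc ∫ w, (X w).dualRPP α ∂P ≤ α * √(∑ i, ∫ w, X w i ^ 2 ∂P) :=
        RealTensor.integral_dualRPP_le hα hX
    _ ≤ α * √(((∑ d, n d : ℕ) : ℝ) ^ D) := by gcongr
    _ ≤ α * (8 * √2 * rppBound (∑ d, n d) D p q) := by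
      gcongr
      exact sqrt_pow_le_rppBound hD hN hp hq
    _ = 8 * √2 * α * rppBound (∑ d, n d) D p q := by ring

theorem mainTheorem5 {Ω : Type*} [MeasurableSpace Ω] (P : Measure Ω) [IsProbabilityMeasure P]
    (D : ℕ) (hD : 1 ≤ D) (n : Fin D → ℕ) (hn : ∀ d, 1 ≤ n d)
    (N : ℕ) (hN : N = ∑ d, n d) (hN2 : 2 ≤ N)
    (nmax : ℕ) (hnmax : nmax = Finset.univ.sup n)
    (X : Ω → RealTensor n)
    (hlaw : ∀ i, HasLaw (fun w => X w i) (gaussianReal 0 1) P)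
    (hindep : iIndepFun (fun i w => X w i) P)
    (α : ℝ) (hα : 0 ≤ α) :
    Integrable (fun w => (X w).dualRPP α) P ∧
    ∀ r c : ℕ, 1 ≤ r → r ≤ N →
      (c = (r - 1).choose (D - 1) ∨ c = (D - 1).choose (r - 1)) → c ≠ 0 →
      ∀ p q : ℝ, p = c * 3 ^ (r * nmax) → q = r * nmax + ((r : ℝ) / D) ^ D →
        ∫ w, (X w).dualRPP α ∂P ≤ 8 * √2 * α * rppBound N D p q := by
  subst hN hnmax
  have hsq (i) : ∫ w, X w i ^ 2 ∂P = 1 := by simpa using integral_sq_of_hasLaw_gaussianReal (hlaw i)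
  have hmul {r : ℕ} (hr : 1 ≤ r) : 1 ≤ r * Finset.univ.sup n :=
    Nat.mul_pos hr ((hn ⟨0, hD⟩).trans (Finset.le_sup (Finset.mem_univ _)))
  exact (mainTheorem5_general hN2 (fun i => (hlaw i).hasGaussianLaw.memLp_two)
    (fun i => (hsq i).le) hα).imp_right fun h r c hr _ _ hc p q hp hq => h p q
      (hp ▸ exp_one_le_natCast_mul_three_pow hc (Nat.pos_iff_ne_zero.1 (hmul hr)))
      (hq ▸ le_add_of_le_of_nonneg (by exact_mod_cast hmul hr) (by positivity))
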